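/- Let $A$ and $B$ be finite alphabets. A (finite) transducer over $A,B$ is a tuple $\mathcal T=(Q,I,F,\Delta,\rho,\tau)$ with finite state set $Q$, initial states $I\subseteq Q$, final states $F\subseteq Q$, transitions $\Delta\subseteq Q\times A\times Q$, output function $\rho:\Delta\to B^*$ and terminal function $\tau:F\to B^*$. The output of a run is the concatenation of the outputs of its transitions, and $[\![\mathcal T]\!]$ is the set of pairs $(u,v\,\tau(q))$ such that some run on $u$ from an initial state to the final state $q$ outputs $v$. $\mathcal T$ is sequential if $|I|=1$ and for all $(q,a)\in Q\times A$ there is at most one $q'$ with $(q,a,q')\in\Delta$; in this case $[\![\mathcal T]\!]$ is the graph of a partial function, also written $\mathcal T$. A specification $S\subseteq A^*\times B^*$ is sequentially realisable if there is a finite sequential transducer $\mathcal R$ with $\mathrm{dom}(\mathcal R)=\mathrm{dom}(S)$ and $(u,\mathcal R(u))\in S$ for all $u\in\mathrm{dom}(S)$. Synthesis game. For $D:Q\to 2^{B^*}$ put $\mathrm{live}(D)=\{q: D(q)\neq\varnothing\}$; for $a\in A$ let $\ell$ be the longest common prefix of all words $w\,\rho(t)$ with $w\in D(q)$, $t=(q,a,q')\in\Delta$,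 and let $\mathrm{next}(D,a)$ be the set of all pairs $(q',\ell^{-1}w\,\rho(t))$ for these $w$, $t$ (so $\mathrm{next}(D,a)=\varnothing$ if there are none). For $K\in\mathbb N$, the $K$-synthesis game of $\mathcal T$ is played by Adam and Eve on pairs $(C,D)$ with $C\subseteq Q$ and $D:Q\to 2^{B^{\le K}}$, starting from $(I,D_0)$ with $D_0(q)=\{\epsilon\}$ for $q\in I$ and $D_0(q)=\varnothing$ otherwise. In a round from $(C,D)$, Adam picks $a\in A$, then Eve picks a set $\alpha\subseteq\mathrm{next}(D,a)$ of pairs whose words have length at most $K$, and the game moves to $(C',D_\alpha)$, where $C'$ is the set of states reached from $C$ by reading $a$ and $D_\alpha(q)=\{w:(q,w)\in\alpha\}$. A position $(C,D)$ is unsafe if $C\cap F\neq\varnothing$ but $\mathrm{live}(D)\cap F=\varnothing$. Eve wins the game if she has a strategy such that no play consistent with it ever visits an unsafe position. Proposition (bounded delay). Let $n\in\mathbb N$, let $\mathcal D_1,\dots,\mathcal D_n$ be sequential transducers over $A,B$, and let $S=[\![\mathcal T]\!]$ be the specification defined by their disjoint union $\mathcal T=\biguplus_{i=1}^n\mathcal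 D_i$. Let $L$ be the maximal length of an output $\rho(t)$ of a transition $t$ of $\mathcal T$, and let $M$ be the maximal number of states of one of the $\mathcal D_i$ (a maximum over the empty set being $0$). Then $S$ is sequentially realisable if and only if Eve wins the $K$-synthesis game of $\mathcal T$ for $K=L\,(6M)^{n^2}$. -/

import Mathlib

/-- A (real-time, nondeterministic) transducer with input alphabet `A`, output alphabet `B` and
state space `Q`. The output function `ρ` matters only on the transitions in `Δ`, and the terminal
function `τ` only on the final states in `F`: no notion below looks at other values. Finiteness
of `A`, `B`, `Q` is required where transducers are used. -/
structure Transducer (A B Q : Type*) where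
  /-- initial states -/
  I : Set Q
  /-- final (accepting) states -/
  F : Set Q
  /-- transitions of the input automaton -/
  Δ : Set (Q × A × Q)
  /-- output function, on transitions -/
  ρ : Q × A × Q → List B
  /-- terminal function, on final states -/
  τ : Q → List B

namespace Transducer

section Basic

variable {A B Q : Type*}

/-- `T.Run p u v q`: there is a run of `T` on the input word `u` from `p` to `q` which produces
the output word `v`. -/
inductive Run (T : Transducer A B Q) : Q → List A → List B → Q → Prop
  | nil (q : Q) : Run T q [] [] q
  | cons {p q r : Q} {a : A} {u : List A} {v : List B} (ht : (p, a, q) ∈ T.Δ)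
      (h : Run T q u v r) : Run T p (a :: u) (T.ρ (p, a, q) ++ v) r

/-- The relation (specification) defined by a transducer. -/
def relation (T : Transducer A B Q) : Set (List A × List B) :=
  {x | ∃ p ∈ T.I, ∃ q ∈ T.F, ∃ v, T.Run p x.1 v q ∧ x.2 = v ++ T.τ q}

/-- A transducer is sequential if its input automaton is deterministic: there is exactly one
initial state, and every state has at most one successor for every input symbol. -/
def IsSequential (T : Transducer A B Q) : Prop :=
  (∃! q, q ∈ T.I) ∧
    ∀ q a q₁ q₂, (q, a, q₁) ∈ T.Δ → (q, a, q₂) ∈ T.Δ → q₁ = q₂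

/-- The length of a longest output word on a transition (`0` if there is no transition). -/
noncomputable def maxOutput (T : Transducer A B Q) : ℕ :=
  sSup {k | ∃ t ∈ T.Δ, k = (T.ρ t).length}

end Basic

section DisjointUnion

variable {A B : Type*} {n : ℕ} {Q : Fin n → Type*}

/-- A transition of the `i`-th component, seen in the disjoint union. -/
def injTransition (i : Fin n) (t : Q i × A × Q i) : (Σ i, Q i) × A × (Σ i, Q i) :=
  (⟨i, t.1⟩, t.2.1, ⟨i, t.2.2⟩)

/-- The disjoint union of `n` transducers: the state set is the disjoint union of the state sets,
and all other components are the unions of those of the `D i`. -/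
def disjointUnion (D : ∀ i, Transducer A B (Q i)) : Transducer A B (Σ i, Q i) where
  I := {q | q.2 ∈ (D q.1).I}
  F := {q | q.2 ∈ (D q.1).F}
  Δ := {t | ∃ i, ∃ s ∈ (D i).Δ, t = injTransition i s}
  ρ := fun t => if h : t.2.2.1 = t.1.1 then (D t.1.1).ρ (t.1.2, t.2.1, h ▸ t.2.2.2) else []
  τ := fun q => (D q.1).τ q.2

/-- The output of a transition in the disjoint union is its output in its component. -/
theorem disjointUnion_ρ (D : ∀ i, Transducer A B (Q i)) (i : Fin n) (s : Q i × A × Q i) :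
    (disjointUnion D).ρ (injTransition i s) = (D i).ρ s :=
  dif_pos (show (injTransition i s).2.2.1 = (injTransition i s).1.1 from rfl)

end DisjointUnion

end Transducer

/-- The domain of a specification. -/
def specDom {A B : Type*} (S : Set (List A × List B)) : Set (List A) :=
  {u | ∃ v, (u, v) ∈ S}

/-- A specification `S` is sequentially realisable if there is a finite sequential transducer `R`
with the same domain as `S` such that `(u, R(u)) ∈ S` for every `u` in this domain. (State sets in
`Type` suffice, because every finite type is in bijection with some `Fin k`.) -/
def SequentiallyRealisable {A B : Type*} (S : Set (List A × List B)) : Prop :=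
  ∃ (P : Type) (_ : Finite P) (R : Transducer A B P), R.IsSequential ∧
    specDom R.relation = specDom S ∧
    ∀ u ∈ specDom S, ∀ v, (u, v) ∈ R.relation → (u, v) ∈ S

section LongestCommonPrefix

variable {B : Type*}

/-- `l` is the longest common prefix of the words in `W`. -/
def IsLongestCommonPrefix (W : Set (List B)) (l : List B) : Prop :=
  (∀ w ∈ W, l <+: w) ∧ ∀ p : List B, (∀ w ∈ W, p <+: w) → p <+: l

theorem exists_isLongestCommonPrefix {W : Set (List B)} (hW : W.Nonempty) :
    ∃ l, IsLongestCommonPrefix W l := by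
  classical
  obtain ⟨w₀, hw₀⟩ := hW
  let P : ℕ → Prop := fun k => ∃ l : List B, l.length = k ∧ ∀ w ∈ W, l <+: w
  have hP : P 0 := ⟨[], rfl, fun w _ => List.nil_prefix⟩
  obtain ⟨l, hl, hlW⟩ := Nat.findGreatest_spec (P := P) (Nat.zero_le w₀.length) hP
  refine ⟨l, hlW, fun p hp => ?_⟩
  refine List.prefix_of_prefix_length_le (hp w₀ hw₀) (hlW w₀ hw₀) ?_
  rw [hl]
  exact Nat.le_findGreatest (hp w₀ hw₀).length_le ⟨p, rfl, hp⟩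

open Classical in
/-- The longest common prefix of a nonempty set of words (the empty word for the empty set). -/
noncomputable def longestCommonPrefix (W : Set (List B)) : List B :=
  if h : W.Nonempty then (exists_isLongestCommonPrefix h).choose else []

theorem longestCommonPrefix_spec {W : Set (List B)} (hW : W.Nonempty) :
    IsLongestCommonPrefix W (longestCommonPrefix W) := by
  rw [longestCommonPrefix, dif_pos hW]
  exact (exists_isLongestCommonPrefix hW).choose_spec

end LongestCommonPrefix

/-- A two-player turn-based safety game between Adam, who moves first, and Eve, with action-labelled
transitions. `VA`, `VE` are the vertices, and `AA`, `AE` the actions, of Adam and Eve. -/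
structure SafetyGame (VA VE AA AE : Type*) where
  /-- initial vertex -/
  init : VA
  /-- transitions of Adam -/
  TA : Set (VA × AA × VE)
  /-- transitions of Eve -/
  TE : Set (VE × AE × VA)
  /-- safe vertices -/
  Safe : Set VA

namespace SafetyGame

variable {VA VE AA AE : Type*}

/-- `G.Play s h v`: there is a finite play from the initial vertex to the vertex `v` of Adam, in
which Eve follows the strategy `s` and whose rounds are listed in `h` (for every round: the vertex
of Adam, his action, and the resulting vertex of Eve). -/
inductive Play (G : SafetyGame VA VE AA AE) (s : List (VA × AA × VE) → AE) :
    List (VA × AA × VE) → VA → Prop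
  | init : Play G s [] G.init
  | step {h : List (VA × AA × VE)} {v v' : VA} {a : AA} {e : VE} (hp : Play G s h v)
      (ha : (v, a, e) ∈ G.TA) (he : (e, s (h ++ [(v, a, e)]), v') ∈ G.TE) :
      Play G s (h ++ [(v, a, e)]) v'

/-- Eve wins if she has a strategy, choosing an action from the history of the play, such that all
plays consistent with it only visit safe vertices, and such that the action chosen is always
available. -/
def EveWins (G : SafetyGame VA VE AA AE) : Prop :=
  ∃ s : List (VA × AA × VE) → AE, ∀ h v, G.Play s h v →
    v ∈ G.Safe ∧ ∀ a e, (v, a, e) ∈ G.TA → ∃ v', (e, s (h ++ [(v, a, e)]), v') ∈ G.TE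

/-- The restriction of a game to given sets of vertices and of actions of Eve. -/
def restrict (G : SafetyGame VA VE AA AE) (PA : Set VA) (PE : Set VE) (N : Set AE) :
    SafetyGame VA VE AA AE where
  init := G.init
  TA := {t | t ∈ G.TA ∧ t.1 ∈ PA ∧ t.2.2 ∈ PE}
  TE := {t | t ∈ G.TE ∧ t.1 ∈ PE ∧ t.2.1 ∈ N ∧ t.2.2 ∈ PA}
  Safe := G.Safe ∩ PA

end SafetyGame

namespace Transducer

variable {A B Q : Type*}

/-- The states to which `D` assigns at least one delay. -/
def live (D : Q → Set (List B)) : Set Q := {q | (D q).Nonempty}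

/-- The safe output of `D` for the input symbol `a`. -/
noncomputable def safeOutput (T : Transducer A B Q) (D : Q → Set (List B)) (a : A) : List B :=
  longestCommonPrefix
    {x | ∃ q q' w, w ∈ D q ∧ (q, a, q') ∈ T.Δ ∧ x = w ++ T.ρ (q, a, q')}

/-- The pair (state, delay) that follows `(q, w)` after the transition `t`, if the prefix `u` of
`w ++ T.ρ t` is output. -/
def nextPair (T : Transducer A B Q) (x : Q × List B) (t : Q × A × Q) (u : List B) : Q × List B :=
  (t.2.2, (x.2 ++ T.ρ t).drop u.length)

/-- The set of pairs (state, delay) that follow `D` after the input symbol `a`. -/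
noncomputable def next (T : Transducer A B Q) (D : Q → Set (List B)) (a : A) :
    Set (Q × List B) :=
  {y | ∃ q q' w, w ∈ D q ∧ (q, a, q') ∈ T.Δ ∧
    y = T.nextPair (q, w) (q, a, q') (T.safeOutput D a)}

open Classical in
/-- The synthesis game. A vertex of Adam is a pair `(C, D)` of a set of states and an assignment of
sets of delays to states; a vertex of Eve is such a pair with an input symbol. Adam picks an
arbitrary input symbol, Eve picks a subset of the possible pairs (state, delay). A vertex `(C, D)`
is unsafe if `C` contains an accepting state, but `live D` does not. -/
noncomputable def synthesisGame (T : Transducer A B Q) :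
    SafetyGame (Set Q × (Q → Set (List B))) ((Set Q × (Q → Set (List B))) × A)
      A (Set (Q × List B)) where
  init := (T.I, fun q => if q ∈ T.I then {[]} else ∅)
  TA := {t | t.2.2 = (t.1, t.2.1)}
  TE := {t | ∃ (C : Set Q) (D : Q → Set (List B)) (a : A) (α : Set (Q × List B)),
    α ⊆ T.next D a ∧
    t = (((C, D), a), α, ({q' | ∃ q ∈ C, (q, a, q') ∈ T.Δ}, fun q => {w | (q, w) ∈ α}))}
  Safe := {v | (v.1 ∩ T.F).Nonempty → (live v.2 ∩ T.F).Nonempty}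

/-- The `K`-synthesis game: the restriction of the synthesis game to delays of length at most
`K`. -/
noncomputable def kSynthesisGame (T : Transducer A B Q) (K : ℕ) :
    SafetyGame (Set Q × (Q → Set (List B))) ((Set Q × (Q → Set (List B))) × A)
      A (Set (Q × List B)) :=
  T.synthesisGame.restrict
    {v | ∀ q, ∀ w ∈ v.2 q, w.length ≤ K}
    {e | ∀ q, ∀ w ∈ e.1.2 q, w.length ≤ K}
    {α | ∀ x ∈ α, x.2.length ≤ K}

end Transducer

/-! If Eve wins with bounded delays, only finitely many positions occur, and they serve as the
states of a sequential transducer that emits the safe output in each round. A delay `w` stored at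
`q` certifies a run to `q` whose output is the emitted word followed by `w`, so safety provides a
correct terminal output.

Conversely, let `R` be a realiser. Run all components in parallel as one deterministic machine with
one output tape each, and measure the delay of two outputs `x`, `y` by `x⁻¹y` in the free group. A
set `P` of tapes is separable at `u` if, for every `c`, some word with the same state and the same
delays inside `P` drives all tapes outside `P` further than `c` from `R`. On such words `R` must
agree, up to terminal outputs, with an accepting tape. So `P` contains an accepting tape whenever
some component accepts, and Eve may drop all other tapes.

If a loop changes the delay of two tapes in `P`, iterating it gives delays `a⁻ᵏ g bᵏ` that are
pairwise distinct, because roots in a free group are unique. Their norms are then unbounded, the two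
tapes cannot both stay close to `R`, and `P` can be shrunk (`Separable.exists_subset_of_loop`).
Hence `P` can be chosen so that no loop changes its delays (`Separable.exists_stable`). If this
holds at all prefixes, every state contributes at most one letter to a delay, which is therefore
bounded by `L` times the number of product states (`negLength_delay_append_le`). One further `L`
pays for the letter read before Eve drops tapes. -/

/-! ### Words in the free group -/

namespace FreeGroup

variable {B : Type*}

/-- The image of a word in the free group. -/
def word (l : List B) : FreeGroup B := mk (l.map fun b => (b, true))

@[simp] theorem word_nil : word ([] : List B) = 1 := rfl

@[simp] theorem word_append (x y : List B) : word (x ++ y) = word x * word y := by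
  simp [word, mul_mk]

variable [DecidableEq B]

theorem norm_word_le (x : List B) : (word x).norm ≤ x.length :=
  norm_mk_le.trans (by simp)

/-- The number of inverse generators in the reduced word of an element. -/
def negLength (g : FreeGroup B) : ℕ := g.toWord.countP fun x => !x.2

@[simp] theorem negLength_one : negLength (1 : FreeGroup B) = 0 := by simp [negLength]

theorem negLength_mul_le (g h : FreeGroup B) : negLength (g * h) ≤ negLength g + negLength h := by
  unfold negLength
  rw [← List.countP_append]
  exact (toWord_mul_sublist g h).countP_le

theorem negLength_word (x : List B) : negLength (word x) = 0 := by
  have h : (word x).toWord.Sublist (x.map fun b => (b, true)) := by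
    rw [word, toWord_mk]
    exact Red.sublist reduce.red
  refine Nat.le_zero.1 (h.countP_le.trans ?_)
  simp [List.countP_map, Function.comp_def]

theorem negLength_le_norm (g : FreeGroup B) : negLength g ≤ g.norm := List.countP_le_length

theorem negLength_inv_word_le (x : List B) : negLength (word x)⁻¹ ≤ x.length :=
  (negLength_le_norm _).trans (norm_inv_eq.trans_le (norm_word_le x))

theorem _root_.List.exists_eq_append_of_maximal_prefix (x y : List B) :
    ∃ c s t, x = c ++ s ∧ y = c ++ t ∧ ∀ b ∈ s.head?, b ∉ t.head? := by
  induction x generalizing y with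
  | nil => exact ⟨[], [], y, by simp⟩
  | cons a x ih =>
    cases y with
    | nil => exact ⟨[], a :: x, [], by simp⟩
    | cons b y =>
      by_cases hab : a = b
      · obtain ⟨c, s, t, rfl, rfl, h⟩ := ih y
        exact ⟨a :: c, s, t, by simp, by simp [hab], h⟩
      · exact ⟨[], a :: x, b :: y, by simp, by simp, by simpa [eq_comm] using hab⟩

theorem toWord_inv_word_mul_word {s t : List B} (h : ∀ b ∈ s.head?, b ∉ t.head?) :
    ((word s)⁻¹ * word t).toWord = s.reverse.map (fun b => (b, false)) ++
      t.map fun b => (b, true) := by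
  have hw : (word s)⁻¹ * word t = mk (s.reverse.map (fun b => (b, false)) ++
      t.map fun b => (b, true)) := by
    simp [word, inv_mk, invRev, mul_mk, Function.comp_def]
  rw [hw, toWord_mk]
  apply IsReduced.reduce_eq
  rw [IsReduced, List.isChain_append]
  refine ⟨?_, ?_, ?_⟩
  · rw [List.isChain_map]
    exact List.Pairwise.isChain (List.pairwise_of_forall (by simp))
  · rw [List.isChain_map]
    exact List.Pairwise.isChain (List.pairwise_of_forall (by simp))
  · simp only [List.map_reverse, List.getLast?_reverse, List.head?_map, Option.mem_def,
      Option.map_eq_some_iff]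
    rintro _ ⟨b, hb, rfl⟩ _ ⟨b', hb', rfl⟩ rfl
    exact absurd hb' (h _ hb)

/-- Once the longest common prefix is cancelled, `s⁻¹t` is reduced, so its inverse letters are
exactly the part of `x` not shared with `y`. This translates group estimates into lengths of Eve's
delays. -/
theorem negLength_inv_word_mul_word_le_iff {x y : List B} {k : ℕ} :
    negLength ((word x)⁻¹ * word y) ≤ k ↔ ∃ c s, x = c ++ s ∧ c <+: y ∧ s.length ≤ k := by
  constructor
  · intro hk
    obtain ⟨c, s, t, rfl, rfl, h⟩ := List.exists_eq_append_of_maximal_prefix x y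
    refine ⟨c, s, rfl, List.prefix_append _ _, ?_⟩
    have hg : (word (c ++ s))⁻¹ * word (c ++ t) = (word s)⁻¹ * word t := by
      simp [mul_assoc]
    rw [hg, negLength, toWord_inv_word_mul_word h] at hk
    simpa [List.countP_map, Function.comp_def] using hk
  · rintro ⟨c, s, rfl, ⟨t, rfl⟩, hs⟩
    have hg : (word (c ++ s))⁻¹ * word (c ++ t) = (word s)⁻¹ * word t := by
      simp [mul_assoc]
    rw [hg]
    refine (negLength_mul_le _ _).trans ?_
    rw [negLength_word]
    exact (negLength_inv_word_le s).trans hs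

theorem finite_norm_le [Finite B] (m : ℕ) : {g : FreeGroup B | g.norm ≤ m}.Finite :=
  Set.Finite.of_finite_image ((List.finite_length_le (B × Bool) m).subset
    (by rintro _ ⟨g, hg, rfl⟩; exact hg)) toWord_injective.injOn

/-- A coincidence at `k` and `k + p` with `p ≠ 0` gives `(g b g⁻¹)ᵖ = aᵖ`. Uniqueness of roots
yields `g b g⁻¹ = a`, so already one step would fix `g`. -/
theorem _root_.injective_inv_pow_mul_mul_pow {G : Type*} [Group G] [IsMulTorsionFree G]
    {a g b : G} (h : a⁻¹ * g * b ≠ g) : Function.Injective fun k : ℕ => (a ^ k)⁻¹ * g * b ^ k := by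
  have key : ∀ k p : ℕ, (a ^ k)⁻¹ * g * b ^ k = (a ^ (k + p))⁻¹ * g * b ^ (k + p) → p = 0 := by
    intro k p hkp
    by_contra hp
    apply h
    have h1 : g * b ^ p = a ^ p * g := by
      have h2 : (a ^ (k + p))⁻¹ * g * b ^ (k + p)
          = (a ^ k)⁻¹ * ((a ^ p)⁻¹ * (g * b ^ p)) * b ^ k := by
        rw [pow_add a, add_comm k p, pow_add b]
        simp only [mul_inv_rev, mul_assoc]
        rw [← mul_assoc (a ^ p)⁻¹, ← mul_inv_rev, ← pow_add, add_comm k p, pow_add, mul_inv_rev]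
        simp only [mul_assoc]
      rw [h2] at hkp
      have h3 : g = (a ^ p)⁻¹ * (g * b ^ p) := by simpa using hkp
      rw [eq_inv_mul_iff_mul_eq] at h3
      exact h3.symm
    have h2 : (g * b * g⁻¹) ^ p = a ^ p := by
      rw [conj_pow, h1]; group
    have h3 : g * b * g⁻¹ = a := pow_left_injective hp h2
    rw [← h3]; group
  intro k l hkl
  rcases le_total k l with hle | hle
  · obtain ⟨p, rfl⟩ := Nat.exists_eq_add_of_le hle
    simp [key k p hkl]
  · obtain ⟨p, rfl⟩ := Nat.exists_eq_add_of_le hle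
    simp [key l p hkl.symm]

theorem _root_.inv_pow_mul_mul_pow_eq {G : Type*} [Group G] {a g b : G} (h : a⁻¹ * g * b = g)
    (k : ℕ) : (a ^ k)⁻¹ * g * b ^ k = g := by
  induction k with
  | zero => simp
  | succ k ih =>
    calc (a ^ (k + 1))⁻¹ * g * b ^ (k + 1) = a⁻¹ * ((a ^ k)⁻¹ * g * b ^ k) * b := by
          rw [pow_succ, pow_succ, mul_inv_rev]; group
      _ = g := by rw [ih, h]

theorem finite_norm_inv_pow_mul_mul_pow_le [Finite B] {a g b : FreeGroup B}
    (h : a⁻¹ * g * b ≠ g) (m : ℕ) : {k : ℕ | ((a ^ k)⁻¹ * g * b ^ k).norm ≤ m}.Finite :=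
  (finite_norm_le m).preimage (injective_inv_pow_mul_mul_pow h).injOn

end FreeGroup

open FreeGroup

/-! ### Deterministic machines with several output tapes -/

/-- A complete deterministic machine over the input alphabet `A` with output tapes `ι`. -/
structure OutputMachine (A B X ι : Type*) where
  init : X
  step : X → A → X
  out : ι → X → A → List B

namespace OutputMachine

variable {A B X Y ι : Type*}

section Eval

variable (S : OutputMachine A B X ι)

/-- The state reached from the initial state. -/
def state (u : List A) : X := u.foldl S.step S.init

/-- The output produced from a given state on a given tape. -/
def outputFrom (i : ι) : X → List A → List B
  | _, [] => []
  | x, a :: u => S.out i x a ++ outputFrom i (S.step x a) u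

/-- The output produced from the initial state on a given tape. -/
def output (i : ι) (u : List A) : List B := S.outputFrom i S.init u

theorem outputFrom_append (i : ι) (x : X) (u v : List A) :
    S.outputFrom i x (u ++ v) = S.outputFrom i x u ++ S.outputFrom i (u.foldl S.step x) v := by
  induction u generalizing x with
  | nil => rfl
  | cons a u ih => simp [outputFrom, ih]

theorem output_append (i : ι) (u v : List A) :
    S.output i (u ++ v) = S.output i u ++ S.outputFrom i (S.state u) v :=
  S.outputFrom_append i _ u v

theorem output_concat (i : ι) (u : List A) (a : A) :
    S.output i (u ++ [a]) = S.output i u ++ S.out i (S.state u) a := by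
  simp [output_append, outputFrom]

theorem state_append (u v : List A) : S.state (u ++ v) = v.foldl S.step (S.state u) := by
  simp [state]

theorem state_concat (u : List A) (a : A) : S.state (u ++ [a]) = S.step (S.state u) a := by
  simp [state]

theorem foldl_flatten_replicate {x : X} {y : List A} (hy : y.foldl S.step x = x) (k : ℕ) :
    (List.replicate k y).flatten.foldl S.step x = x := by
  induction k with
  | zero => rfl
  | succ k ih => simpa [List.replicate_succ, hy] using ih

theorem word_outputFrom_flatten_replicate {x : X} {y : List A} (hy : y.foldl S.step x = x)
    (i : ι) (k : ℕ) :
    word (S.outputFrom i x (List.replicate k y).flatten) = word (S.outputFrom i x y) ^ k := by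
  induction k with
  | zero => rfl
  | succ k ih => simp [List.replicate_succ, outputFrom_append, hy, ih, pow_succ']

/-- The delay between the outputs on two tapes, as an element of the free group. -/
def delay (i j : ι) (u : List A) : FreeGroup B := (word (S.output i u))⁻¹ * word (S.output j u)

theorem delay_append (i j : ι) (u v : List A) :
    S.delay i j (u ++ v) = (word (S.outputFrom i (S.state u) v))⁻¹ * S.delay i j u *
      word (S.outputFrom j (S.state u) v) := by
  simp [delay, output_append, mul_assoc]

/-- No loop on the state of `u` changes a delay between tapes in `P`. -/
def Stable (P : Finset ι) (u : List A) : Prop :=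
  ∀ y, S.state (u ++ y) = S.state u → ∀ i ∈ P, ∀ j ∈ P, S.delay i j (u ++ y) = S.delay i j u

variable {S} in
theorem Stable.mono {P P' : Finset ι} {u : List A} (h : S.Stable P u) (hP : P' ⊆ P) :
    S.Stable P' u :=
  fun y hy i hi j hj => h y hy i (hP hi) j (hP hj)

end Eval

/-! ### Separating tapes from a realiser -/

variable [DecidableEq B] (S : OutputMachine A B X ι) (R : OutputMachine A B Y Unit)

/-- The delay between the output of `R` and the output of `S` on a tape. -/
def gap (j : ι) (u : List A) : FreeGroup B := (word (R.output () u))⁻¹ * word (S.output j u)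

theorem norm_gap_le_norm_gap_append (j : ι) (u v : List A) :
    (S.gap R j u).norm ≤ (S.gap R j (u ++ v)).norm + (R.outputFrom () (R.state u) v).length +
      (S.outputFrom j (S.state u) v).length := by
  have h : S.gap R j u = word (R.outputFrom () (R.state u) v) * S.gap R j (u ++ v) *
      (word (S.outputFrom j (S.state u) v))⁻¹ := by
    simp [gap, output_append, mul_assoc]
  rw [h]
  have h1 := FreeGroup.norm_mul_le (word (R.outputFrom () (R.state u) v) * S.gap R j (u ++ v))
    (word (S.outputFrom j (S.state u) v))⁻¹
  have h2 := FreeGroup.norm_mul_le (word (R.outputFrom () (R.state u) v)) (S.gap R j (u ++ v))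
  have h3 := norm_word_le (R.outputFrom () (R.state u) v)
  have h4 := norm_word_le (S.outputFrom j (S.state u) v)
  rw [norm_inv_eq] at h1
  omega

theorem norm_delay_le (i j : ι) (u : List A) :
    (S.delay i j u).norm ≤ (S.gap R i u).norm + (S.gap R j u).norm := by
  have h : S.delay i j u = (S.gap R i u)⁻¹ * S.gap R j u := by simp [delay, gap, mul_assoc]
  rw [h]
  exact (FreeGroup.norm_mul_le _ _).trans (by rw [norm_inv_eq])

/-- Some word leads to the same state as `u` and produces the same delays between tapes in `P`,
but all other tapes are further than `c` from the output of `R`. -/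
def SeparableBy (P : Finset ι) (u : List A) (c : ℕ) : Prop :=
  ∃ u', S.state u' = S.state u ∧ (∀ i ∈ P, ∀ j ∈ P, S.delay i j u' = S.delay i j u) ∧
    ∀ j ∉ P, c < (S.gap R j u').norm

/-- The tapes outside `P` can be separated arbitrarily far from the output of `R`, without
changing the state and the delays between tapes in `P`. -/
def Separable (P : Finset ι) (u : List A) : Prop := ∀ c, S.SeparableBy R P u c

variable {S R}

theorem SeparableBy.mono {P : Finset ι} {u : List A} {c d : ℕ} (h : S.SeparableBy R P u d)
    (hcd : c ≤ d) : S.SeparableBy R P u c := by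
  obtain ⟨u', h1, h2, h3⟩ := h
  exact ⟨u', h1, h2, fun j hj => hcd.trans_lt (h3 j hj)⟩

theorem separable_univ [Fintype ι] (u : List A) : S.Separable R Finset.univ u := fun _ =>
  ⟨u, rfl, fun _ _ _ _ => rfl, fun j hj => absurd (Finset.mem_univ j) hj⟩

/-- Appending a fixed word to words ending in the state of `u` changes the gaps by a bounded
amount. -/
theorem exists_gap_bound [Finite Y] [Finite ι] (S : OutputMachine A B X ι)
    (R : OutputMachine A B Y Unit) (u v : List A) :
    ∃ b, ∀ u', S.state u' = S.state u → ∀ j,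
      (S.gap R j u').norm ≤ (S.gap R j (u' ++ v)).norm + b := by
  -- The state of `R` after `u'` is not controlled, so the maximum runs over all states of `R`.
  obtain ⟨bR, hR⟩ := Finite.exists_le fun y : Y => (R.outputFrom () y v).length
  obtain ⟨bS, hS⟩ := Finite.exists_le fun j : ι => (S.outputFrom j (S.state u) v).length
  refine ⟨bR + bS, fun u' hu' j => ?_⟩
  have h := S.norm_gap_le_norm_gap_append R j u' v
  rw [hu'] at h
  have h1 := hR (R.state u')
  have h2 := hS j
  omega

theorem Separable.append [Finite Y] [Finite ι] {P : Finset ι} {u : List A}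
    (h : S.Separable R P u) (v : List A) : S.Separable R P (u ++ v) := by
  intro c
  obtain ⟨b, hb⟩ := exists_gap_bound S R u v
  obtain ⟨u', h1, h2, h3⟩ := h (c + b)
  refine ⟨u' ++ v, by simp [state_append, h1], fun i hi j hj => ?_, fun j hj => ?_⟩
  · rw [delay_append, delay_append, h1, h2 i hi j hj]
  · have := h3 j hj
    have := hb u' h1 j
    omega

/-- Pumping `y` makes every delay changed by `y` large, so by the triangle inequality the tapes of
`P` that remain close to `R` have pairwise unchanged delays; these form `P'`. -/
theorem Separable.exists_subset_of_loop [Finite B] [Finite Y] [Finite ι] {P : Finset ι}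
    {u : List A} (h : S.Separable R P u) {y : List A} (hy : S.state (u ++ y) = S.state u) :
    ∃ P' ⊆ P, S.Separable R P' u ∧
      ∀ i ∈ P', ∀ j ∈ P', S.delay i j (u ++ y) = S.delay i j u := by
  have hy' : y.foldl S.step (S.state u) = S.state u := by rw [← state_append, hy]
  have key : ∀ c, ∃ P' ⊆ P, S.SeparableBy R P' u c ∧
      ∀ i ∈ P', ∀ j ∈ P', S.delay i j (u ++ y) = S.delay i j u := by
    intro c
    -- The bad exponents: some changed delay has norm at most `2c`, as it would if both tapes were
    -- within `c` of `R`. Finitely many are bad, so some `k` avoids them all.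
    have hfin : (⋃ p : {p : ι × ι // S.delay p.1 p.2 (u ++ y) ≠ S.delay p.1 p.2 u},
        {k : ℕ | ((word (S.outputFrom p.1.1 (S.state u) y) ^ k)⁻¹ * S.delay p.1.1 p.1.2 u *
          word (S.outputFrom p.1.2 (S.state u) y) ^ k).norm ≤ c + c}).Finite :=
      Set.finite_iUnion fun p => finite_norm_inv_pow_mul_mul_pow_le
        (by rw [← delay_append]; exact p.2) _
    obtain ⟨k, hk⟩ := hfin.exists_notMem
    simp only [Set.mem_iUnion, Set.mem_ofPred_eq, not_exists, not_le, Subtype.forall,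
      Prod.forall] at hk
    set w := (List.replicate k y).flatten with hw
    obtain ⟨b, hb⟩ := exists_gap_bound S R u w
    obtain ⟨u', h1, h2, h3⟩ := h (c + b)
    have hdelay : ∀ i ∈ P, ∀ j ∈ P, S.delay i j (u' ++ w) =
        (word (S.outputFrom i (S.state u) y) ^ k)⁻¹ * S.delay i j u *
          word (S.outputFrom j (S.state u) y) ^ k := by
      intro i hi j hj
      rw [delay_append, h1, h2 i hi j hj, word_outputFrom_flatten_replicate _ hy',
        word_outputFrom_flatten_replicate _ hy']
    have hloop : ∀ i ∈ P, ∀ j ∈ P, (S.gap R i (u' ++ w)).norm ≤ c →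
        (S.gap R j (u' ++ w)).norm ≤ c → S.delay i j (u ++ y) = S.delay i j u := by
      intro i hi j hj hic hjc
      by_contra hne
      have h4 := hk i j hne
      rw [← hdelay i hi j hj] at h4
      have h5 := S.norm_delay_le R i j (u' ++ w)
      omega
    classical
    refine ⟨P.filter fun j => (S.gap R j (u' ++ w)).norm ≤ c, Finset.filter_subset _ _,
      ⟨u' ++ w, ?_, ?_, ?_⟩, ?_⟩
    · rw [state_append, h1, hw, foldl_flatten_replicate _ hy']
    · intro i hi j hj
      rw [Finset.mem_filter] at hi hj
      have h4 := hloop i hi.1 j hj.1 hi.2 hj.2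
      rw [delay_append] at h4
      rw [hdelay i hi.1 j hj.1]
      exact inv_pow_mul_mul_pow_eq h4 k
    · intro j hj
      by_cases hjP : j ∈ P
      · simpa [hjP] using hj
      · have := h3 j hjP
        have := hb u' h1 j
        omega
    · intro i hi j hj
      rw [Finset.mem_filter] at hi hj
      exact hloop i hi.1 j hj.1 hi.2 hj.2
  -- The set found by `key` depends on `c`. If each of the finitely many candidates failed at some
  -- threshold, the one found for the maximal threshold would give a contradiction.
  by_contra! hcon
  have hc : ∀ P' : Finset ι, ∃ c, ¬ (P' ⊆ P ∧ S.SeparableBy R P' u c ∧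
      ∀ i ∈ P', ∀ j ∈ P', S.delay i j (u ++ y) = S.delay i j u) := by
    intro P'
    by_contra! hP'
    obtain ⟨i, hi, j, hj, hij⟩ := hcon P' (hP' 0).1 fun c => (hP' c).2.1
    exact hij ((hP' 0).2.2 i hi j hj)
  choose c hc using hc
  obtain ⟨m, hm⟩ := Finite.exists_le c
  obtain ⟨P', h1, h2, h3⟩ := key m
  exact hc P' ⟨h1, h2.mono (hm P'), h3⟩

theorem Separable.exists_stable [Finite B] [Finite Y] [Finite ι] {P : Finset ι} {u : List A}
    (h : S.Separable R P u) : ∃ P' ⊆ P, S.Separable R P' u ∧ S.Stable P' u := by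
  induction P using Finset.strongInduction with
  | H P ih =>
    by_cases hP : S.Stable P u
    · exact ⟨P, subset_rfl, h, hP⟩
    · unfold Stable at hP
      push Not at hP
      obtain ⟨y, hy, i, hi, j, hj, hij⟩ := hP
      obtain ⟨P', hP', h1, h2⟩ := h.exists_subset_of_loop hy
      have hss : P' ⊂ P := by
        refine hP'.ssubset_of_ne ?_
        rintro rfl
        exact hij (h2 i hi j hj)
      obtain ⟨P'', h3, h4⟩ := ih P' hss h1
      exact ⟨P'', h3.trans hP', h4⟩

/-- `P` is separable at `u`, and stable at all prefixes of `u`. -/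
def Good (S : OutputMachine A B X ι) (R : OutputMachine A B Y Unit) (P : Finset ι)
    (u : List A) : Prop :=
  S.Separable R P u ∧ ∀ x, x <+: u → S.Stable P x

theorem exists_good_nil [Finite B] [Finite Y] [Finite ι] (S : OutputMachine A B X ι)
    (R : OutputMachine A B Y Unit) : ∃ P, S.Good R P [] := by
  cases nonempty_fintype ι
  obtain ⟨P, -, h1, h2⟩ := (separable_univ (S := S) (R := R) []).exists_stable
  refine ⟨P, h1, fun x hx => ?_⟩
  rwa [List.prefix_nil.1 hx]

/-- Stability passes to subsets, so shrinking at the new word preserves it at earlier prefixes. -/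
theorem Good.exists_concat [Finite B] [Finite Y] [Finite ι] {P : Finset ι} {u : List A}
    (h : S.Good R P u) (a : A) : ∃ P' ⊆ P, S.Good R P' (u ++ [a]) := by
  obtain ⟨P', hP, h1, h2⟩ := (h.1.append [a]).exists_stable
  refine ⟨P', hP, h1, fun x hx => ?_⟩
  rcases List.prefix_concat_iff.1 hx with rfl | hx
  · exact h2
  · exact (h.2 x hx).mono hP

/-! ### Stability bounds delays -/

theorem _root_.List.exists_last_prefix {α : Type*} (p : List α → Prop) (h : p []) (z : List α) :
    ∃ z₁ z₂, z = z₁ ++ z₂ ∧ p z₁ ∧ ∀ t, t <+: z₂ → t ≠ [] → ¬ p (z₁ ++ t) := by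
  induction z using List.reverseRecOn with
  | nil => exact ⟨[], [], rfl, h, fun t ht hne => absurd (List.prefix_nil.1 ht) hne⟩
  | append_singleton z a ih =>
    by_cases hz : p (z ++ [a])
    · exact ⟨z ++ [a], [], by simp, hz, fun t ht hne => absurd (List.prefix_nil.1 ht) hne⟩
    · obtain ⟨z₁, z₂, rfl, h1, h2⟩ := ih
      refine ⟨z₁, z₂ ++ [a], by simp, h1, fun t ht hne => ?_⟩
      rcases List.prefix_concat_iff.1 ht with rfl | ht
      · simpa using hz
      · exact h2 t ht hne

/-- Only the output on tape `i` enters inverted; that on tape `j` adds no inverse letters. Hence `L`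
rather than `2L`. -/
theorem negLength_delay_concat_le {L : ℕ} (hL : ∀ i x a, (S.out i x a).length ≤ L) (i j : ι)
    (u : List A) (a : A) :
    negLength (S.delay i j (u ++ [a])) ≤ negLength (S.delay i j u) + L := by
  rw [delay_append]
  refine (negLength_mul_le _ _).trans ?_
  rw [negLength_word]
  refine (negLength_mul_le _ _).trans ?_
  have := (negLength_inv_word_le (S.outputFrom i (S.state u) [a])).trans
    (by simpa [outputFrom] using hL i (S.state u) a)
  omega

theorem negLength_delay_append_le {L : ℕ} (hL : ∀ i x a, (S.out i x a).length ≤ L)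
    {P : Finset ι} {i j : ι} (hi : i ∈ P) (hj : j ∈ P) (T : Finset X) (x z : List A)
    (hst : ∀ p, p <+: x ++ z → S.Stable P p)
    (hT : ∀ t, t <+: z → t ≠ [] → S.state (x ++ t) ∈ T) :
    negLength (S.delay i j (x ++ z)) ≤ negLength (S.delay i j x) + L * T.card := by
  classical
  induction T using Finset.strongInduction generalizing x z with
  | H T ih =>
    cases z with
    | nil => simp
    | cons a z =>
      have ha : S.state (x ++ [a]) ∈ T := hT [a] (by simp) (by simp)
      -- Cut at the last return to the state reached by `a`: the loop `z₁` leaves the delay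
      -- unchanged by stability, and `z₂` avoids that state, which can be erased from `T`.
      obtain ⟨z₁, z₂, rfl, h1, h2⟩ := List.exists_last_prefix
        (fun t => S.state (x ++ [a] ++ t) = S.state (x ++ [a])) (by simp) z
      have hstab := hst (x ++ [a]) (by simp) z₁ h1 i hi j hj
      have hrec := ih (T.erase (S.state (x ++ [a]))) (Finset.erase_ssubset ha)
        (x ++ [a] ++ z₁) z₂ (by simpa using hst) (fun t ht hne => Finset.mem_erase.2 ⟨?_, ?_⟩)
      · have hcard := Finset.card_erase_add_one ha
        have hc := negLength_delay_concat_le hL i j x a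
        rw [hstab] at hrec
        have he : x ++ a :: (z₁ ++ z₂) = x ++ [a] ++ z₁ ++ z₂ := by simp
        rw [he, ← hcard, mul_add]
        omega
      · simpa using h2 t ht hne
      · have := hT (a :: (z₁ ++ t)) (by simpa using ht) (by simp)
        simpa using this

theorem Good.negLength_delay_le [Finite X] {L : ℕ} (hL : ∀ i x a, (S.out i x a).length ≤ L)
    {P : Finset ι} {u : List A} (h : S.Good R P u) {i j : ι} (hi : i ∈ P) (hj : j ∈ P) :
    negLength (S.delay i j u) ≤ L * Nat.card X := by
  cases nonempty_fintype X
  have := negLength_delay_append_le hL hi hj Finset.univ [] u (by simpa using h.2)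
    (fun _ _ _ => Finset.mem_univ _)
  rw [Finset.card_univ, ← Nat.card_eq_fintype_card] at this
  simpa [delay, output, outputFrom] using this

/-- Some tape in `P` is close to `R`, if this holds for some tape at all words that lead to the
state of `u`. -/
theorem Good.exists_mem {P : Finset ι} {u : List A} (h : S.Good R P u) {p : ι → Prop} {c : ℕ}
    (hp : ∀ u', S.state u' = S.state u → ∃ j, p j ∧ (S.gap R j u').norm ≤ c) :
    ∃ j ∈ P, p j := by
  obtain ⟨u', h1, -, h3⟩ := h.1 c
  obtain ⟨j, hj, hjc⟩ := hp u' h1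
  refine ⟨j, ?_, hj⟩
  by_contra hjP
  exact absurd (h3 j hjP) hjc.not_gt

end OutputMachine

namespace Transducer

/-! ### Runs of transducers -/

section Runs

variable {A B Q : Type*} {T : Transducer A B Q}

theorem run_nil_iff {p q : Q} {v : List B} : T.Run p [] v q ↔ v = [] ∧ q = p := by
  constructor
  · rintro ⟨⟩
    exact ⟨rfl, rfl⟩
  · rintro ⟨rfl, rfl⟩
    exact .nil _

theorem run_cons_iff {p r : Q} {a : A} {u : List A} {v : List B} :
    T.Run p (a :: u) v r ↔
      ∃ q v', (p, a, q) ∈ T.Δ ∧ T.Run q u v' r ∧ v = T.ρ (p, a, q) ++ v' := by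
  constructor
  · rintro (_ | ⟨ht, h⟩)
    exact ⟨_, _, ht, h, rfl⟩
  · rintro ⟨q, v', ht, h, rfl⟩
    exact .cons ht h

theorem run_concat_iff {p r : Q} {a : A} {u : List A} {v : List B} :
    T.Run p (u ++ [a]) v r ↔
      ∃ q v', T.Run p u v' q ∧ (q, a, r) ∈ T.Δ ∧ v = v' ++ T.ρ (q, a, r) := by
  induction u generalizing p v with
  | nil =>
    simp only [List.nil_append, run_cons_iff, run_nil_iff]
    constructor
    · rintro ⟨q, v', h, ⟨rfl, rfl⟩, rfl⟩
      exact ⟨p, [], ⟨rfl, rfl⟩, h, by simp⟩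
    · rintro ⟨q, v', ⟨rfl, rfl⟩, h, rfl⟩
      exact ⟨r, [], h, ⟨rfl, rfl⟩, by simp⟩
  | cons b u ih =>
    simp only [List.cons_append, run_cons_iff, ih]
    constructor
    · rintro ⟨q, v', h, ⟨s, w, hs, hr, rfl⟩, rfl⟩
      exact ⟨s, _, ⟨q, w, h, hs, rfl⟩, hr, by simp⟩
    · rintro ⟨s, v', ⟨q, w, h, hs, rfl⟩, hr, rfl⟩
      exact ⟨q, _, h, ⟨s, w, hs, hr, rfl⟩, by simp⟩

theorem length_ρ_le_maxOutput [Finite A] [Finite Q] {t : Q × A × Q} (ht : t ∈ T.Δ) :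
    (T.ρ t).length ≤ T.maxOutput := by
  refine le_csSup ?_ ⟨t, ht, rfl⟩
  refine ((Set.toFinite T.Δ).image fun t => (T.ρ t).length).bddAbove.mono ?_
  rintro _ ⟨t, ht, rfl⟩
  exact ⟨t, ht, rfl⟩

open Classical in
/-- A successor of a state, if there is one. -/
noncomputable def successor (T : Transducer A B Q) (a : A) (q : Q) : Option Q :=
  if h : ∃ q', (q, a, q') ∈ T.Δ then some h.choose else none

theorem IsSequential.successor_eq_some_iff (hT : T.IsSequential) {a : A} {q q' : Q} :
    T.successor a q = some q' ↔ (q, a, q') ∈ T.Δ := by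
  unfold successor
  split_ifs with h
  · rw [Option.some_inj]
    exact ⟨fun he => he ▸ h.choose_spec, fun hq => hT.2 _ _ _ _ h.choose_spec hq⟩
  · simpa using fun hq => h ⟨q', hq⟩

end Runs

/-! ### The product of sequential transducers -/

section Product

variable {A B ι : Type*} {Q : ι → Type*}

/-- The completed product of a family of transducers, with one output tape for each of them. -/
noncomputable def product (D : ∀ i, Transducer A B (Q i)) (q₀ : ∀ i, Q i) :
    OutputMachine A B (∀ i, Option (Q i)) ι where
  init := fun i => some (q₀ i)
  step := fun x a i => (x i).bind ((D i).successor a)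
  out := fun i x a => (x i).elim [] fun q =>
    ((D i).successor a q).elim [] fun q' => (D i).ρ (q, a, q')

variable {D : ∀ i, Transducer A B (Q i)} {q₀ : ∀ i, Q i}

theorem product_state_concat (hD : ∀ i, (D i).IsSequential) {u : List A} {a : A} {i : ι}
    {r : Q i} : (product D q₀).state (u ++ [a]) i = some r ↔
      ∃ q, (product D q₀).state u i = some q ∧ (q, a, r) ∈ (D i).Δ := by
  simp [OutputMachine.state_concat, product, Option.bind_eq_some_iff,
    (hD i).successor_eq_some_iff]

theorem product_output_concat (hD : ∀ i, (D i).IsSequential) {u : List A} {a : A} {i : ι}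
    {q r : Q i} (hq : (product D q₀).state u i = some q) (hr : (q, a, r) ∈ (D i).Δ) :
    (product D q₀).output i (u ++ [a]) = (product D q₀).output i u ++ (D i).ρ (q, a, r) := by
  rw [OutputMachine.output_concat]
  congr 1
  show Option.elim ((product D q₀).state u i) _ _ = _
  rw [hq, Option.elim_some, (hD i).successor_eq_some_iff.2 hr, Option.elim_some]

theorem run_iff_product (hD : ∀ i, (D i).IsSequential) {u : List A} {v : List B} {i : ι}
    {q : Q i} : (D i).Run (q₀ i) u v q ↔
      (product D q₀).state u i = some q ∧ (product D q₀).output i u = v := by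
  induction u using List.reverseRecOn generalizing v q with
  | nil =>
    rw [run_nil_iff]
    simp [OutputMachine.state, OutputMachine.output, OutputMachine.outputFrom, product, eq_comm,
      and_comm]
  | append_singleton u a ih =>
    simp only [run_concat_iff, ih]
    constructor
    · rintro ⟨q', v', ⟨hq, rfl⟩, ht, rfl⟩
      exact ⟨(product_state_concat hD).2 ⟨q', hq, ht⟩, product_output_concat hD hq ht⟩
    · rintro ⟨h, rfl⟩
      obtain ⟨q', hq, ht⟩ := (product_state_concat hD).1 h
      exact ⟨q', _, ⟨hq, rfl⟩, ht, product_output_concat hD hq ht⟩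

theorem mem_relation_iff_product (hD : ∀ i, (D i).IsSequential) (hq₀ : ∀ i, q₀ i ∈ (D i).I)
    {u : List A} {v : List B} {i : ι} : (u, v) ∈ (D i).relation ↔
      ∃ q ∈ (D i).F, (product D q₀).state u i = some q ∧
        v = (product D q₀).output i u ++ (D i).τ q := by
  constructor
  · rintro ⟨p, hp, q, hq, v', hr, rfl⟩
    rw [(hD i).1.unique hp (hq₀ i), run_iff_product hD] at hr
    exact ⟨q, hq, hr.1, by rw [hr.2]⟩
  · rintro ⟨q, hq, h, rfl⟩
    exact ⟨q₀ i, hq₀ i, q, hq, _, (run_iff_product hD).2 ⟨h, rfl⟩, rfl⟩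

end Product

/-! ### Disjoint unions -/

section DisjointUnion

variable {A B : Type*} {n : ℕ} {Q : Fin n → Type*} {D : ∀ i, Transducer A B (Q i)}

theorem mem_disjointUnion_Δ {i j : Fin n} {q : Q i} {a : A} {r : Q j} :
    ((⟨i, q⟩, a, ⟨j, r⟩) : (Σ i, Q i) × A × (Σ i, Q i)) ∈ (disjointUnion D).Δ ↔
      ∃ r', (⟨j, r⟩ : Σ i, Q i) = ⟨i, r'⟩ ∧ (q, a, r') ∈ (D i).Δ := by
  constructor
  · rintro ⟨k, ⟨q', a', r'⟩, hs, h⟩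
    simp only [injTransition, Prod.mk.injEq] at h
    obtain ⟨h1, rfl, h2⟩ := h
    obtain ⟨rfl, h1⟩ := Sigma.mk.inj_iff.1 h1
    obtain rfl := eq_of_heq h1
    exact ⟨r', h2, hs⟩
  · rintro ⟨r', h, hs⟩
    exact ⟨i, (q, a, r'), hs, by rw [h]; rfl⟩

theorem mk_mem_disjointUnion_Δ {i : Fin n} {q : Q i} {a : A} {r : Q i} :
    ((⟨i, q⟩, a, ⟨i, r⟩) : (Σ i, Q i) × A × (Σ i, Q i)) ∈ (disjointUnion D).Δ ↔
      (q, a, r) ∈ (D i).Δ := by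
  simp [mem_disjointUnion_Δ]

theorem disjointUnion_ρ_mk {i : Fin n} {q : Q i} {a : A} {r : Q i} :
    (disjointUnion D).ρ (⟨i, q⟩, a, ⟨i, r⟩) = (D i).ρ (q, a, r) :=
  disjointUnion_ρ D i (q, a, r)

theorem disjointUnion_run_iff {i j : Fin n} {q : Q i} {u : List A} {v : List B} {r : Q j} :
    (disjointUnion D).Run ⟨i, q⟩ u v ⟨j, r⟩ ↔
      ∃ r', (⟨j, r⟩ : Σ i, Q i) = ⟨i, r'⟩ ∧ (D i).Run q u v r' := by
  induction u generalizing q v with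
  | nil => simp [run_nil_iff, and_comm]
  | cons a u ih =>
    simp only [run_cons_iff]
    constructor
    · rintro ⟨⟨k, s⟩, v', ht, h, rfl⟩
      obtain ⟨s', hs, ht⟩ := mem_disjointUnion_Δ.1 ht
      rw [hs] at h ⊢
      obtain ⟨r', hr, h⟩ := ih.1 h
      exact ⟨r', hr, s', v', ht, h, by rw [disjointUnion_ρ_mk]⟩
    · rintro ⟨r', hr, s, v', ht, h, rfl⟩
      exact ⟨⟨i, s⟩, v', mk_mem_disjointUnion_Δ.2 ht, ih.2 ⟨r', hr, h⟩,
        by rw [disjointUnion_ρ_mk]⟩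

theorem mem_disjointUnion_relation {x : List A × List B} :
    x ∈ (disjointUnion D).relation ↔ ∃ i, x ∈ (D i).relation := by
  constructor
  · rintro ⟨⟨i, p⟩, hp, ⟨j, q⟩, hq, v, h, hx⟩
    obtain ⟨r, hr, h⟩ := disjointUnion_run_iff.1 h
    obtain ⟨rfl, hr⟩ := Sigma.mk.inj_iff.1 hr
    obtain rfl := eq_of_heq hr
    exact ⟨j, p, hp, q, hq, v, h, hx⟩
  · rintro ⟨i, p, hp, q, hq, v, h, hx⟩
    exact ⟨⟨i, p⟩, hp, ⟨i, q⟩, hq, v, disjointUnion_run_iff.2 ⟨q, rfl, h⟩, hx⟩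

end DisjointUnion

end Transducer

/-! ### Winning strategies as closed sets of positions -/

/-- A strategy that looks only at the last round suffices; the default action is never needed on
consistent plays. -/
theorem SafetyGame.eveWins_of_closed {VA VE AA AE : Type*} [Nonempty AE]
    (G : SafetyGame VA VE AA AE) (V : Set VA) (h₀ : G.init ∈ V) (hsafe : ∀ v ∈ V, v ∈ G.Safe)
    (hstep : ∀ v ∈ V, ∀ a e, (v, a, e) ∈ G.TA → ∃ α,
      (∃ v', (e, α, v') ∈ G.TE) ∧ ∀ v', (e, α, v') ∈ G.TE → v' ∈ V) : G.EveWins := by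
  classical
  have hf : ∀ t : VA × AA × VE, ∃ α, t.1 ∈ V → t ∈ G.TA →
      (∃ v', (t.2.2, α, v') ∈ G.TE) ∧ ∀ v', (t.2.2, α, v') ∈ G.TE → v' ∈ V := by
    intro t
    by_cases ht : t.1 ∈ V ∧ t ∈ G.TA
    · obtain ⟨α, hα⟩ := hstep t.1 ht.1 t.2.1 t.2.2 ht.2
      exact ⟨α, fun _ _ => hα⟩
    · exact ⟨Classical.arbitrary AE, fun h1 h2 => absurd ⟨h1, h2⟩ ht⟩
  choose f hf using hf
  let s : List (VA × AA × VE) → AE := fun h => h.getLast?.elim (Classical.arbitrary AE) f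
  have hs : ∀ h t, s (h ++ [t]) = f t := by simp [s]
  have hV : ∀ h v, G.Play s h v → v ∈ V := by
    intro h v hp
    induction hp with
    | init => exact h₀
    | step hp ha he ih =>
      rw [hs] at he
      exact (hf _ ih ha).2 _ he
  refine ⟨s, fun h v hp => ⟨hsafe v (hV h v hp), fun a e ha => ?_⟩⟩
  rw [hs]
  exact (hf _ (hV h v hp) ha).1

namespace Transducer

section SynthesisGame

variable {A B Q : Type*} {T : Transducer A B Q} {K : ℕ}

/-- The set of states reached from `C` by reading `a`. -/
def post (T : Transducer A B Q) (C : Set Q) (a : A) : Set Q := {q' | ∃ q ∈ C, (q, a, q') ∈ T.Δ}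

/-- A set of safe positions with delays of length at most `K`, in which Eve can stay. -/
structure IsClosed (T : Transducer A B Q) (K : ℕ) (V : Set (Set Q × (Q → Set (List B)))) :
    Prop where
  init_mem : T.synthesisGame.init ∈ V
  length_le : ∀ v ∈ V, ∀ q, ∀ w ∈ v.2 q, w.length ≤ K
  safe : ∀ v ∈ V, (v.1 ∩ T.F).Nonempty → (live v.2 ∩ T.F).Nonempty
  step : ∀ v ∈ V, ∀ a, ∃ α ⊆ T.next v.2 a, (T.post v.1 a, fun q => {w | (q, w) ∈ α}) ∈ V

theorem exists_isClosed_of_eveWins (h : (T.kSynthesisGame K).EveWins) :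
    ∃ V, T.IsClosed K V := by
  obtain ⟨s, hs⟩ := h
  refine ⟨{v | ∃ h, (T.kSynthesisGame K).Play s h v}, ⟨[], .init⟩, ?_, ?_, ?_⟩
  · rintro v ⟨h, hp⟩
    exact (hs h v hp).1.2
  · rintro v ⟨h, hp⟩
    exact (hs h v hp).1.1
  · rintro v ⟨h, hp⟩ a
    have hK := (hs h v hp).1.2
    have hTA : (v, a, (v, a)) ∈ (T.kSynthesisGame K).TA := ⟨rfl, hK, hK⟩
    obtain ⟨v', hv'⟩ := (hs h v hp).2 a (v, a) hTA
    obtain ⟨C, D, a', α, hα, he⟩ := hv'.1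
    simp only [Prod.mk.injEq] at he
    obtain ⟨⟨rfl, rfl⟩, rfl, rfl⟩ := he
    exact ⟨_, hα, _, .step hp hTA hv'⟩

theorem IsClosed.eveWins {V : Set (Set Q × (Q → Set (List B)))} (hV : T.IsClosed K V) :
    (T.kSynthesisGame K).EveWins := by
  refine SafetyGame.eveWins_of_closed _ V hV.init_mem
    (fun v hv => ⟨hV.safe v hv, hV.length_le v hv⟩) ?_
  rintro v hv a e ⟨he, -, hK⟩
  obtain rfl : e = (v, a) := he
  obtain ⟨α, hα, hv'⟩ := hV.step v hv a
  refine ⟨α, ⟨_, ⟨v.1, v.2, a, α, hα, rfl⟩, hK, fun x hx => hV.length_le _ hv' x.1 x.2 hx,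
    hV.length_le _ hv'⟩, ?_⟩
  rintro v' ⟨⟨C, D, a', α', -, he⟩, -⟩
  simp only [Prod.mk.injEq] at he
  obtain ⟨⟨rfl, rfl⟩, rfl, rfl⟩ := he
  exact hv'

theorem finite_length_le_positions [Finite B] [Finite Q] (K : ℕ) :
    {v : Set Q × (Q → Set (List B)) | ∀ q, ∀ w ∈ v.2 q, w.length ≤ K}.Finite := by
  have h : {D : Q → Set (List B) | ∀ q, D q ⊆ {w | w.length ≤ K}}.Finite :=
    Set.forall_finite_image_eval_iff.1 fun q =>
      ((List.finite_length_le B K).finite_subsets).subset (by rintro _ ⟨D, hD, rfl⟩; exact hD q)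
  exact (Set.finite_univ.prod h).subset fun v hv => ⟨trivial, hv⟩

theorem longestCommonPrefix_prefix {W : Set (List B)} {x : List B} (hx : x ∈ W) :
    longestCommonPrefix W <+: x :=
  (longestCommonPrefix_spec ⟨x, hx⟩).1 x hx

/-- A winning strategy of Eve yields a sequential transducer. -/
theorem IsClosed.sequentiallyRealisable [Finite B] [Finite Q]
    {V : Set (Set Q × (Q → Set (List B)))} (hV : T.IsClosed K V) :
    SequentiallyRealisable T.relation := by
  classical
  have hfin : V.Finite := (finite_length_le_positions K).subset hV.length_le
  obtain ⟨k, f, -, hf⟩ := hfin.fin_param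
  have hfV : ∀ p, f p ∈ V := fun p => hf ▸ Set.mem_range_self p
  obtain ⟨p₀, hp₀⟩ : ∃ p, f p = T.synthesisGame.init := by
    simpa [← hf] using hV.init_mem
  have hnext : ∀ p a, ∃ p', (f p').1 = T.post (f p).1 a ∧
      ∀ q w, w ∈ (f p').2 q → (q, w) ∈ T.next (f p).2 a := by
    intro p a
    obtain ⟨α, hα, hv⟩ := hV.step _ (hfV p) a
    rw [← hf] at hv
    obtain ⟨p', hp'⟩ := hv
    refine ⟨p', by rw [hp'], fun q w hw => hα ?_⟩
    rw [hp'] at hw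
    exact hw
  choose g hg₁ hg₂ using hnext
  have hend : ∀ p, ∃ t : List B, ((f p).1 ∩ T.F).Nonempty →
      ∃ q ∈ T.F, ∃ w ∈ (f p).2 q, t = w ++ T.τ q := by
    intro p
    by_cases hp : ((f p).1 ∩ T.F).Nonempty
    · obtain ⟨q, ⟨w, hw⟩, hq⟩ := hV.safe _ (hfV p) hp
      exact ⟨w ++ T.τ q, fun _ => ⟨q, hq, w, hw, rfl⟩⟩
    · exact ⟨[], fun h => absurd h hp⟩
  choose τ hτ using hend
  -- The input automaton is complete; the domain is cut down by the final states alone, via the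
  -- first component of the position.
  let R : Transducer A B (Fin k) :=
    { I := {p₀}
      F := {p | ((f p).1 ∩ T.F).Nonempty}
      Δ := {t | t.2.2 = g t.1 t.2.1}
      ρ := fun t => T.safeOutput (f t.1).2 t.2.1
      τ := τ }
  have htotal : ∀ u, ∃ p v, R.Run p₀ u v p := by
    intro u
    induction u using List.reverseRecOn with
    | nil => exact ⟨p₀, [], .nil _⟩
    | append_singleton u a ih =>
      obtain ⟨p, v, h⟩ := ih
      exact ⟨g p a, _, run_concat_iff.2 ⟨p, v, h, show g p a = g p a from rfl, rfl⟩⟩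
  have hC : ∀ u p v, R.Run p₀ u v p → (f p).1 = {q | ∃ q₀ ∈ T.I, ∃ v', T.Run q₀ u v' q} := by
    intro u
    induction u using List.reverseRecOn with
    | nil =>
      intro p v h
      obtain ⟨rfl, rfl⟩ := run_nil_iff.1 h
      ext q
      simp [hp₀, synthesisGame, run_nil_iff]
    | append_singleton u a ih =>
      intro p v h
      obtain ⟨p', v', h', ht, rfl⟩ := run_concat_iff.1 h
      obtain rfl : p = g p' a := ht
      rw [hg₁, ih _ _ h']
      ext q
      simp only [post, run_concat_iff, Set.mem_ofPred_eq]
      constructor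
      · rintro ⟨q', ⟨q₀, hq₀, w, hw⟩, ht⟩
        exact ⟨q₀, hq₀, _, q', w, hw, ht, rfl⟩
      · rintro ⟨q₀, hq₀, _, q', w, hw, ht, rfl⟩
        exact ⟨q', ⟨q₀, hq₀, w, hw⟩, ht⟩
  -- The invariant behind correctness: emitted output followed by a stored delay is the output of a
  -- run of `T`.
  have hD : ∀ u p v, R.Run p₀ u v p → ∀ q, ∀ w ∈ (f p).2 q,
      ∃ q₀ ∈ T.I, T.Run q₀ u (v ++ w) q := by
    intro u
    induction u using List.reverseRecOn with
    | nil =>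
      intro p v h q w hw
      obtain ⟨rfl, rfl⟩ := run_nil_iff.1 h
      rw [hp₀] at hw
      by_cases hq : q ∈ T.I
      · obtain rfl : w = [] := by simpa [synthesisGame, hq] using hw
        exact ⟨q, hq, .nil _⟩
      · simp [synthesisGame, hq] at hw
    | append_singleton u a ih =>
      intro p v h q w hw
      obtain ⟨p', v', h', ht, rfl⟩ := run_concat_iff.1 h
      obtain rfl : p = g p' a := ht
      obtain ⟨q₁, q₂, w₁, hw₁, ht, he⟩ := hg₂ _ _ _ _ hw
      simp only [nextPair, Prod.mk.injEq] at he
      obtain ⟨rfl, hwe⟩ := he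
      obtain ⟨q₀, hq₀, hr⟩ := ih _ _ h' _ _ hw₁
      refine ⟨q₀, hq₀, run_concat_iff.2 ⟨q₁, _, hr, ht, ?_⟩⟩
      obtain ⟨x, hx⟩ : T.safeOutput (f p').2 a <+: w₁ ++ T.ρ (q₁, a, q) :=
        longestCommonPrefix_prefix ⟨q₁, q, w₁, hw₁, ht, rfl⟩
      rw [hwe, ← hx, List.drop_left, List.append_assoc, List.append_assoc, ← hx]
  have hsub : ∀ x ∈ R.relation, x ∈ T.relation := by
    rintro ⟨u, v'⟩ ⟨p, hp, p', hp', v, hr, hv⟩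
    obtain rfl : p = p₀ := hp
    obtain rfl : v' = v ++ τ p' := hv
    obtain ⟨q, hq, w, hw, hw'⟩ := hτ p' hp'
    obtain ⟨q₀, hq₀, h⟩ := hD _ _ _ hr q w hw
    exact ⟨q₀, hq₀, q, hq, v ++ w, h, by simp [hw']⟩
  refine ⟨Fin k, inferInstance, R, ⟨⟨p₀, rfl, fun _ h => h⟩, ?_⟩, ?_, ?_⟩
  · rintro p a p₁ p₂ h₁ h₂
    exact Eq.trans h₁ (Eq.symm h₂)
  · ext u
    constructor
    · rintro ⟨v, hv⟩
      exact ⟨v, hsub _ hv⟩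
    · rintro ⟨_, q₀, hq₀, q, hq, v, hr, -⟩
      obtain ⟨p, v', hp⟩ := htotal u
      refine ⟨v' ++ τ p, p₀, rfl, p, ⟨q, ?_, hq⟩, v', hp, rfl⟩
      rw [hC _ _ _ hp]
      exact ⟨q₀, hq₀, v, hr⟩
  · intro u _ v hv
    exact hsub _ hv

end SynthesisGame

end Transducer

/-! ### From a realiser to a winning strategy -/

namespace Transducer

/-- Removing the last `k` letters of `x` leaves a prefix of every word in `W`, hence of their
longest common prefix. -/
theorem length_le_of_negLength_le {B : Type*} [DecidableEq B] {W : Set (List B)} {x : List B}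
    {k : ℕ} (hx : x ∈ W) (h : ∀ y ∈ W, negLength ((word x)⁻¹ * word y) ≤ k) :
    x.length ≤ (longestCommonPrefix W).length + k := by
  have hp : x.take (x.length - k) <+: longestCommonPrefix W := by
    refine (longestCommonPrefix_spec ⟨x, hx⟩).2 _ fun y hy => ?_
    obtain ⟨c, s, rfl, hc, hs⟩ := negLength_inv_word_mul_word_le_iff.1 (h y hy)
    refine List.IsPrefix.trans ?_ hc
    rw [List.take_append_of_le_length (by simp; omega)]
    exact List.take_prefix _ _
  have := hp.length_le
  simp at this
  omega

section Product

variable {A B : Type*} {n : ℕ} {Q : Fin n → Type*} {D : ∀ i, Transducer A B (Q i)}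
  {q₀ : ∀ i, Q i}

theorem length_product_out_le [Finite A] [∀ i, Finite (Q i)] (hD : ∀ i, (D i).IsSequential)
    (i : Fin n) (x : ∀ i, Option (Q i)) (a : A) :
    ((product D q₀).out i x a).length ≤ (disjointUnion D).maxOutput := by
  show (Option.elim (x i) [] _).length ≤ _
  rcases x i with _ | q
  · simp
  · show (Option.elim ((D i).successor a q) [] _).length ≤ _
    rcases h : (D i).successor a q with _ | q'
    · simp
    · rw [Option.elim_some, ← disjointUnion_ρ_mk]
      exact length_ρ_le_maxOutput
        (mk_mem_disjointUnion_Δ.2 ((hD i).successor_eq_some_iff.1 h))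

/-- If the specification is realised by `R`, then separable sets of components contain an
accepting component whenever there is one. -/
theorem exists_final_mem_of_good [DecidableEq B] [∀ i, Finite (Q i)]
    (hD : ∀ i, (D i).IsSequential) (hq₀ : ∀ i, q₀ i ∈ (D i).I) {P : Type} [Finite P]
    {R : Transducer A B P} (hR : R.IsSequential) {r₀ : P} (hr₀ : r₀ ∈ R.I)
    (hdom : specDom R.relation = specDom (disjointUnion D).relation)
    (hsub : ∀ u ∈ specDom (disjointUnion D).relation, ∀ v, (u, v) ∈ R.relation →
      (u, v) ∈ (disjointUnion D).relation)
    {I : Finset (Fin n)} {u : List A}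
    (hgood : (product D q₀).Good (product (fun _ : Unit => R) fun _ => r₀) I u)
    {i : Fin n} {q : Q i} (hq : q ∈ (D i).F) (hu : (product D q₀).state u i = some q) :
    ∃ j ∈ I, ∃ q ∈ (D j).F, (product D q₀).state u j = some q := by
  obtain ⟨b₁, h₁⟩ := Finite.exists_le fun p => (R.τ p).length
  obtain ⟨b₂, h₂⟩ := Finite.exists_le fun q => ((disjointUnion D).τ q).length
  refine hgood.exists_mem (p := fun j => ∃ q ∈ (D j).F, (product D q₀).state u j = some q)
    (c := b₁ + b₂) fun u' hu' => ?_
  have hmem : u' ∈ specDom (disjointUnion D).relation :=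
    ⟨_, mem_disjointUnion_relation.2
      ⟨i, (mem_relation_iff_product hD hq₀).2 ⟨q, hq, by rw [hu', hu], rfl⟩⟩⟩
  obtain ⟨v, hv⟩ : u' ∈ specDom R.relation := hdom ▸ hmem
  have hvS := hsub u' hmem v hv
  obtain ⟨r, -, -, hvr⟩ := (mem_relation_iff_product (D := fun _ : Unit => R) (fun _ => hR)
    (fun _ => hr₀) (i := ())).1 hv
  obtain ⟨j, hj⟩ := mem_disjointUnion_relation.1 hvS
  obtain ⟨q', hq', hst, hvj⟩ := (mem_relation_iff_product hD hq₀).1 hj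
  refine ⟨j, ⟨q', hq', by rw [← hu', hst]⟩, ?_⟩
  -- Both complete outputs on `u'` agree, so the gap consists of two terminal outputs and is bounded
  -- independently of `u'`.
  have hgap : (product D q₀).gap (product (fun _ : Unit => R) fun _ => r₀) j u' =
      word (R.τ r) * (word ((D j).τ q'))⁻¹ := by
    have := congrArg word (hvr.symm.trans hvj)
    rw [word_append, word_append] at this
    rw [OutputMachine.gap, inv_mul_eq_iff_eq_mul, ← mul_assoc, eq_mul_inv_iff_mul_eq, this]
  rw [hgap]
  refine (FreeGroup.norm_mul_le _ _).trans ?_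
  rw [norm_inv_eq]
  have := norm_word_le (R.τ r)
  have := norm_word_le ((D j).τ q')
  have := h₁ r
  have : ((D j).τ q').length ≤ b₂ := h₂ ⟨j, q'⟩
  omega

/-- The positions of the game in which the live components are those in `J`, and all delays are
relative to a common prefix `p` of their outputs. -/
structure IsPosition (D : ∀ i, Transducer A B (Q i)) (q₀ : ∀ i, Q i) (u : List A)
    (J : Finset (Fin n)) (p : List B)
    (v : Set (Σ i, Q i) × ((Σ i, Q i) → Set (List B))) : Prop where
  fst_eq : v.1 = {q | (product D q₀).state u q.1 = some q.2}
  mem_snd : ∀ q w, w ∈ v.2 q ↔ q.1 ∈ J ∧ (product D q₀).state u q.1 = some q.2 ∧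
    (product D q₀).output q.1 u = p ++ w
  prefix_output : ∀ i ∈ J, ∀ q, (product D q₀).state u i = some q →
    p <+: (product D q₀).output i u

theorem isPosition_init (hD : ∀ i, (D i).IsSequential) (hq₀ : ∀ i, q₀ i ∈ (D i).I) :
    IsPosition D q₀ [] Finset.univ [] (disjointUnion D).synthesisGame.init := by
  have hI : ∀ q, q ∈ (disjointUnion D).I ↔ (product D q₀).state [] q.1 = some q.2 := by
    rintro ⟨i, q⟩
    show q ∈ (D i).I ↔ some (q₀ i) = some q
    rw [Option.some_inj]
    exact ⟨fun h => (hD i).1.unique (hq₀ i) h, fun h => h ▸ hq₀ i⟩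
  refine ⟨Set.ext hI, fun q w => ?_, fun _ _ _ _ => List.nil_prefix⟩
  rw [← hI q]
  by_cases hq : q ∈ (disjointUnion D).I
  · simp [synthesisGame, hq, OutputMachine.output, OutputMachine.outputFrom, eq_comm]
  · simp [synthesisGame, hq]

/-- The words over which the safe output is computed are the outputs of the components that
survive. -/
theorem IsPosition.exists_next (hD : ∀ i, (D i).IsSequential) {u : List A}
    {J : Finset (Fin n)} {p : List B} {v : Set (Σ i, Q i) × ((Σ i, Q i) → Set (List B))}
    (hv : IsPosition D q₀ u J p v) {a : A} {i : Fin n} (hi : i ∈ J) {r : Q i}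
    (hr : (product D q₀).state (u ++ [a]) i = some r) :
    ∃ q w, w ∈ v.2 ⟨i, q⟩ ∧
      ((⟨i, q⟩, a, ⟨i, r⟩) : (Σ i, Q i) × A × (Σ i, Q i)) ∈ (disjointUnion D).Δ ∧
      (product D q₀).output i (u ++ [a]) =
        p ++ (w ++ (disjointUnion D).ρ (⟨i, q⟩, a, ⟨i, r⟩)) := by
  obtain ⟨q, hq, ht⟩ := (product_state_concat hD).1 hr
  obtain ⟨w, hw⟩ := hv.prefix_output i hi q hq
  refine ⟨q, w, (hv.mem_snd _ _).2 ⟨hi, hq, hw.symm⟩, mk_mem_disjointUnion_Δ.2 ht, ?_⟩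
  rw [product_output_concat hD hq ht, disjointUnion_ρ_mk, ← hw, List.append_assoc]

/-- The delay bound is needed on all of `J`, not just `J'`: the safe output is the common prefix
over all surviving live components, including those that Eve is about to drop. -/
theorem IsPosition.step [DecidableEq B] (hD : ∀ i, (D i).IsSequential) {u : List A}
    {J J' : Finset (Fin n)} {p : List B}
    {v : Set (Σ i, Q i) × ((Σ i, Q i) → Set (List B))} (hv : IsPosition D q₀ u J p v)
    (hJ : J' ⊆ J) (a : A) {k : ℕ}
    (hk : ∀ i ∈ J, ∀ j ∈ J, negLength ((product D q₀).delay i j (u ++ [a])) ≤ k) :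
    ∃ α ⊆ (disjointUnion D).next v.2 a, (∀ x ∈ α, x.2.length ≤ k) ∧
      ∃ p', IsPosition D q₀ (u ++ [a]) J' p'
        ((disjointUnion D).post v.1 a, fun q => {w | (q, w) ∈ α}) := by
  set l := (disjointUnion D).safeOutput v.2 a with hl
  have hlp : ∀ i ∈ J, ∀ r, (product D q₀).state (u ++ [a]) i = some r →
      p ++ l <+: (product D q₀).output i (u ++ [a]) := by
    intro i hi r hr
    obtain ⟨q, w, hw, ht, ho⟩ := hv.exists_next hD hi hr
    rw [ho, List.prefix_append_right_inj]
    exact longestCommonPrefix_prefix ⟨_, _, w, hw, ht, rfl⟩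
  refine ⟨{x | x.1.1 ∈ J' ∧ (product D q₀).state (u ++ [a]) x.1.1 = some x.1.2 ∧
    (product D q₀).output x.1.1 (u ++ [a]) = p ++ l ++ x.2}, ?_, ?_, p ++ l, ?_⟩
  · rintro ⟨⟨i, r⟩, w'⟩ ⟨hi, hr, ho⟩
    obtain ⟨q, w, hw, ht, ho'⟩ := hv.exists_next hD (hJ hi) hr
    refine ⟨_, _, w, hw, ht, ?_⟩
    rw [ho', List.append_assoc, List.append_cancel_left_eq] at ho
    simp only [nextPair]
    rw [ho, ← hl, List.drop_left]
  · rintro ⟨⟨i, r⟩, w'⟩ ⟨hi, hr, ho⟩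
    obtain ⟨q, w, hw, ht, ho'⟩ := hv.exists_next hD (hJ hi) hr
    have hx := ho'
    rw [ho, List.append_assoc, List.append_cancel_left_eq] at hx
    have := length_le_of_negLength_le (k := k) (W := {x | ∃ q q' w, w ∈ v.2 q ∧
      (q, a, q') ∈ (disjointUnion D).Δ ∧ x = w ++ (disjointUnion D).ρ (q, a, q')})
      (x := l ++ w') ⟨_, _, w, hw, ht, hx⟩ ?_
    · change (l ++ w').length ≤ l.length + k at this
      simpa using this
    · rintro _ ⟨⟨j, s⟩, ⟨j', s'⟩, z, hz, ht', rfl⟩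
      obtain ⟨s', hs', ht'⟩ := mem_disjointUnion_Δ.1 ht'
      rw [hs', disjointUnion_ρ_mk]
      obtain ⟨hj, hst, hz⟩ := (hv.mem_snd _ _).1 hz
      have := hk i (hJ hi) j hj
      rw [OutputMachine.delay, ho, product_output_concat hD hst ht', hz] at this
      simpa [mul_assoc] using this
  · refine ⟨?_, fun q w => Iff.rfl, fun i hi q hq => hlp i (hJ hi) q hq⟩
    ext ⟨i, r⟩
    simp only [post, hv.fst_eq, Set.mem_ofPred_eq]
    rw [product_state_concat hD]
    constructor
    · rintro ⟨⟨j, q⟩, hq, ht⟩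
      obtain ⟨r', hr, ht⟩ := mem_disjointUnion_Δ.1 ht
      obtain ⟨rfl, hr⟩ := Sigma.mk.inj_iff.1 hr
      obtain rfl := eq_of_heq hr
      exact ⟨q, hq, ht⟩
    · rintro ⟨q, hq, ht⟩
      exact ⟨⟨i, q⟩, hq, mk_mem_disjointUnion_Δ.2 ht⟩

end Product

theorem eveWins_of_sequentiallyRealisable {A B : Type*} [Finite A] [Finite B] {n : ℕ}
    {Q : Fin n → Type*} [∀ i, Finite (Q i)] {D : ∀ i, Transducer A B (Q i)}
    (hD : ∀ i, (D i).IsSequential) {K : ℕ}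
    (hK : (disjointUnion D).maxOutput * Nat.card (∀ i, Option (Q i)) +
      (disjointUnion D).maxOutput ≤ K)
    (h : SequentiallyRealisable (disjointUnion D).relation) :
    ((disjointUnion D).kSynthesisGame K).EveWins := by
  classical
  obtain ⟨P, _, R, hR, hdom, hsub⟩ := h
  choose q₀ hq₀ using fun i => (hD i).1.exists
  obtain ⟨r₀, hr₀⟩ := hR.1.exists
  set k := (disjointUnion D).maxOutput * Nat.card (∀ i, Option (Q i)) with hk
  have hL := length_product_out_le (q₀ := q₀) hD
  -- The live set `J` may exceed the good set `I` because all components are live in the initial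
  -- position; after each round the two coincide.
  refine IsClosed.eveWins (V := {v | ∃ u J I p, IsPosition D q₀ u J p v ∧ I ⊆ J ∧
    (product D q₀).Good (product (fun _ : Unit => R) fun _ => r₀) I u ∧
    (∀ i ∈ J, ∀ j ∈ J, negLength ((product D q₀).delay i j u) ≤ k) ∧
    ∀ q, ∀ w ∈ v.2 q, w.length ≤ K}) ⟨?_, ?_, ?_, ?_⟩
  · obtain ⟨I, hI⟩ := OutputMachine.exists_good_nil (product D q₀)
      (product (fun _ : Unit => R) fun _ => r₀)
    have hpos := isPosition_init hD hq₀
    refine ⟨[], _, I, [], hpos, Finset.subset_univ I, hI, fun i _ j _ => ?_, fun q w hw => ?_⟩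
    · simp [OutputMachine.delay, OutputMachine.output, OutputMachine.outputFrom]
    · have := ((hpos.mem_snd q w).1 hw).2.2
      rw [List.nil_append] at this
      rw [← this]
      simp [OutputMachine.output, OutputMachine.outputFrom]
  · rintro v ⟨u, J, I, p, -, -, -, -, hv⟩
    exact hv
  · rintro v ⟨u, J, I, p, hpos, hIJ, hgood, -, -⟩ ⟨⟨i, q⟩, hq, hqF⟩
    rw [hpos.fst_eq] at hq
    obtain ⟨j, hj, q', hqF', hq'⟩ :=
      exists_final_mem_of_good hD hq₀ hR hr₀ hdom hsub hgood hqF hq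
    obtain ⟨w, hw⟩ := hpos.prefix_output j (hIJ hj) q' hq'
    exact ⟨⟨j, q'⟩, ⟨w, (hpos.mem_snd _ _).2 ⟨hIJ hj, hq', hw.symm⟩⟩, hqF'⟩
  · rintro v ⟨u, J, I, p, hpos, hIJ, hgood, hJ, -⟩ a
    obtain ⟨I', hI', hgood'⟩ := hgood.exists_concat a
    obtain ⟨α, hα, hαk, p', hpos'⟩ := hpos.step hD (hI'.trans hIJ) a
      (k := k + (disjointUnion D).maxOutput) fun i hi j hj =>
        (OutputMachine.negLength_delay_concat_le hL i j u a).trans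
          (Nat.add_le_add_right (hJ i hi j hj) _)
    -- The bound `k` is recovered from goodness of `I'`, so the extra summand for one letter does
    -- not accumulate over rounds.
    exact ⟨α, hα, u ++ [a], I', I', p', hpos', subset_rfl, hgood',
      fun i hi j hj => hgood'.negLength_delay_le hL hi hj,
      fun q w hw => (hαk _ hw).trans hK⟩

/-! ### The numerical bound and the conclusion -/

theorem maxOutput_eq_zero_of_isEmpty {A B Q : Type*} [IsEmpty Q] (T : Transducer A B Q) :
    T.maxOutput = 0 := by
  simp [maxOutput]

end Transducer

/-- Completing each component by a dead state gives at most `(M + 1) ^ n` product states; since `M ≥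
1`, the claimed bound leaves ample room. -/
theorem card_pi_option_add_one_le {n M : ℕ} (hn : n ≠ 0) {Q : Fin n → Type*}
    [∀ i, Finite (Q i)] [∀ i, Nonempty (Q i)] (hM : ∀ i, Nat.card (Q i) ≤ M) :
    Nat.card (∀ i, Option (Q i)) + 1 ≤ (6 * M) ^ n ^ 2 := by
  have h1 : Nat.card (∀ i, Option (Q i)) ≤ (M + 1) ^ n := by
    rw [Nat.card_pi]
    refine (Finset.prod_le_pow_card _ _ (M + 1) fun i _ => ?_).trans (by simp)
    rw [Finite.card_option]
    exact Nat.add_le_add_right (hM i) 1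
  have hM1 : 1 ≤ M := Nat.card_pos.trans_le (hM ⟨0, Nat.pos_of_ne_zero hn⟩)
  calc Nat.card (∀ i, Option (Q i)) + 1 ≤ (M + 1) ^ n + (M + 1) ^ n :=
        Nat.add_le_add h1 (Nat.one_le_pow _ _ (by omega))
    _ = 2 * (M + 1) ^ n := by ring
    _ ≤ 2 ^ n * (M + 1) ^ n := Nat.mul_le_mul_right _ (Nat.le_self_pow hn 2)
    _ = (2 * (M + 1)) ^ n := (mul_pow _ _ _).symm
    _ ≤ (6 * M) ^ n := Nat.pow_le_pow_left (by omega) n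
    _ ≤ (6 * M) ^ n ^ 2 := Nat.pow_le_pow_right (by omega) (Nat.le_self_pow two_ne_zero n)

/-- Bounded delay: a specification `S` defined by a disjoint union of `n` sequential transducers is
sequentially realisable iff Eve wins the `K`-synthesis game for `K = L (6 M) ^ (n ^ 2)`. -/
theorem mainTheorem4 {A B : Type*} [Finite A] [Finite B] (n : ℕ) {Q : Fin n → Type*}
    [∀ i, Finite (Q i)] (D : ∀ i, Transducer A B (Q i)) (hD : ∀ i, (D i).IsSequential)
    (L M : ℕ) (hL : L = (Transducer.disjointUnion D).maxOutput)
    (hM : M = Finset.univ.sup fun i => Nat.card (Q i)) :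
    SequentiallyRealisable (Transducer.disjointUnion D).relation ↔
      ((Transducer.disjointUnion D).kSynthesisGame (L * (6 * M) ^ (n ^ 2))).EveWins := by
  constructor
  · refine Transducer.eveWins_of_sequentiallyRealisable hD ?_
    rw [← hL, ← Nat.mul_succ]
    -- For `n = 0` the exponential factor is `1`, too small for the counting bound, but there are no
    -- transitions and `L = 0`.
    rcases eq_or_ne n 0 with rfl | hn
    · rw [hL, Transducer.maxOutput_eq_zero_of_isEmpty]
      simp
    · have hne : ∀ i, Nonempty (Q i) := fun i => ⟨(hD i).1.exists.choose⟩
      refine Nat.mul_le_mul_left L (card_pi_option_add_one_le hn fun i => ?_)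
      rw [hM]
      exact Finset.le_sup (f := fun i => Nat.card (Q i)) (Finset.mem_univ i)
  · intro h
    obtain ⟨V, hV⟩ := Transducer.exists_isClosed_of_eveWins h
    exact hV.sequentiallyRealisable
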